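/- **Setting.** Let $G=\langle \mathbf V,\mathbf E\rangle$ be a finite directed graph, in which cycles (also self-loops) are allowed. A *generalized additive structural equation model* with graph $G$ consists of a smooth function $f_{ij}:\mathbb R\to\mathbb R$ for every edge $X_j\to X_i$ and of laws for the errors $\epsilon_i$ ($i\in\mathbf V$); random variables $X=(X_i)_{i\in\mathbf V}$ follow the model if, almost surely, $$X_i=\sum_{X_j\in \mathrm{Pa}_G(X_i)} f_{ij}(X_j)+\epsilon_i\qquad(i\in\mathbf V),$$ where the errors $\epsilon_i$ are jointly independent and have the prescribed laws. We assume that the equations determine the variables from the errors: for every ancestral set $\mathbf S\subseteq\mathbf V$ (a set that contains all parents of its elements), the equations of the vertices in $\mathbf S$ have exactly one solution for almost every value of $(\epsilon_i)_{i\in\mathbf S}$. (This is automatic if $G$ is acyclic, and also if the whole model is linear, $X=\Lambda X+\epsilon$, with $I-\Lambda$ invertible.) A *directed path* may revisit vertices and may consist of a single vertex. A *trek* from $a$ to $b$ is a pair $(\pi_1,\pi_2)$ of directed paths with a common first vertex, where $\pi_1$ ends at $a$ and $\pi_2$ ends at $b$. For $\mathbf A,\mathbf B,\mathbf C_A,\mathbf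 C_B\subseteq\mathbf V$, the pair $(\mathbf C_A;\mathbf C_B)$ *t-separates* $\mathbf A$ and $\mathbf B$ if for every trek $(\pi_1,\pi_2)$ from an element of $\mathbf A$ to an element of $\mathbf B$, $\pi_1$ contains a vertex of $\mathbf C_A$ or $\pi_2$ contains a vertex of $\mathbf C_B$. The model is *linear below $\mathbf C_A$ and $\mathbf C_B$ for $\mathbf A$ and $\mathbf B$* if for every edge $X_j\to X_i$ on a directed path from $\mathbf C_A$ to $\mathbf A$ or from $\mathbf C_B$ to $\mathbf B$ the function $f_{ij}$ is linear, $f_{ij}(x)=a_{ij}x$ up to an additive constant. **Theorem.** Let $X$ follow a generalized additive structural equation model with graph $G$ as above, with all $X_i$ of finite variance. Suppose that $(\mathbf C_A;\mathbf C_B)$ t-separates $\mathbf A$ and $\mathbf B$ and that the model is linear below $\mathbf C_A$ and $\mathbf C_B$ for $\mathbf A$ and $\mathbf B$; the other edges need not be linear. Let $F$ be a set of linear edges that includes all edges on directed paths from $\mathbf C_A$ to $\mathbf A$ or from $\mathbf C_B$ to $\mathbf B$, and let $L$ be its coefficient matrix, $L_{ij}=a_{ij}$ if the edge $X_j\to X_i$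 is in $F$ and $L_{ij}=0$ otherwise. If $I-L$ is invertible, then the cross-covariance matrix $\Sigma_{\mathbf A,\mathbf B}=(\mathrm{Cov}(X_a,X_b))_{a\in\mathbf A,\,b\in\mathbf B}$ satisfies $$\operatorname{rank}(\Sigma_{\mathbf A,\mathbf B})\le |\mathbf C_A|+|\mathbf C_B| .$$ -/

import Mathlib

open MeasureTheory ProbabilityTheory

/-! ### Directed paths, treks and t-separation -/

/-- `p` is the list of vertices of a directed path from `s` to `t` in `G`. A path may revisit
vertices, and the one-vertex list is the path without edges from a vertex to itself. -/
def IsDirectedPath {V : Type*} (G : Digraph V) (s t : V) (p : List V) : Prop :=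
  p.IsChain G.Adj ∧ p.head? = some s ∧ p.getLast? = some t

/-- `(CA; CB)` t-separates `A` and `B`: for every trek `(p, q)`, i.e. every pair of directed paths
with a common first vertex, `p` ending in `A` and `q` ending in `B`, either `p` meets `CA` or `q`
meets `CB`. -/
def TSeparates {V : Type*} (G : Digraph V) (CA CB A B : Finset V) : Prop :=
  ∀ a ∈ A, ∀ b ∈ B, ∀ (s : V) (p q : List V),
    IsDirectedPath G s a p → IsDirectedPath G s b q →
      (∃ c ∈ CA, c ∈ p) ∨ (∃ c ∈ CB, c ∈ q)

/-- The edge `i → j` lies on some directed path from a vertex of `C` to a vertex of `S`. -/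
def EdgeOnPath {V : Type*} (G : Digraph V) (C S : Finset V) (i j : V) : Prop :=
  ∃ c ∈ C, ∃ a ∈ S, ∃ p : List V, IsDirectedPath G c a p ∧ [i, j] <:+: p

/-! ### Generalized additive structural equation models -/

open scoped ContDiff in
/-- A (fixed parameter) generalized additive structural equation model: a directed graph, which may
have cycles, a smooth function `f j i` for each edge `j → i`, and a law for each error. It stands
for the equations `X i = ∑ f j i (X j) + ε i`, the sum being over the parents `j` of `i`, with
independent errors `ε i`. The values of `f` off the edges play no role. -/
structure AdditiveSEM (V : Type*) where
  /-- the directed graph -/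
  graph : Digraph V
  /-- the function attached to the edge `j → i` -/
  f : V → V → ℝ → ℝ
  /-- these functions are smooth -/
  smooth : ∀ j i, graph.Adj j i → ContDiff ℝ ∞ (f j i)
  /-- the law of the error of `i` -/
  errorLaw : V → ProbabilityMeasure ℝ

namespace AdditiveSEM

variable {V : Type*}

/-- A set of vertices is ancestral if it contains the parents of its elements. -/
def IsAncestral (M : AdditiveSEM V) (S : Finset V) : Prop :=
  ∀ j i, M.graph.Adj j i → i ∈ S → j ∈ S

open Classical in
/-- `x` solves the equations of the vertices in `S` for the errors `e`
(used for ancestral `S`, where these equations involve no other vertices). -/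
def SolvesOn (M : AdditiveSEM V) (S : Finset V) (e x : S → ℝ) : Prop :=
  ∀ i : S, x i = (∑ j : S, if M.graph.Adj j i then M.f j i (x j) else 0) + e i

/-- The equations determine the variables from the errors: for every ancestral set of vertices,
the equations of this set have exactly one solution for almost all values of its errors. -/
def UniquelySolvable (M : AdditiveSEM V) : Prop :=
  ∀ S : Finset V, M.IsAncestral S →
    ∀ᵐ e ∂(Measure.pi fun i : S => (M.errorLaw i : Measure ℝ)), ∃! x : S → ℝ, M.SolvesOn S e x

open Classical in
/-- The random variables `X` follow the model `M`, with errors `ε`: the errors are jointly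
independent and have the prescribed laws, and the structural equations hold almost surely. -/
structure Follows [Fintype V] (M : AdditiveSEM V) {Ω : Type*} [MeasurableSpace Ω] (μ : Measure Ω)
    (ε X : V → Ω → ℝ) : Prop where
  measurable_error : ∀ i, Measurable (ε i)
  measurable_var : ∀ i, Measurable (X i)
  law_error : ∀ i, μ.map (ε i) = (M.errorLaw i : Measure ℝ)
  indep_error : iIndepFun ε μ
  equation : ∀ i, ∀ᵐ ω ∂μ,
    X i ω = (∑ j, if M.graph.Adj j i then M.f j i (X j ω) else 0) + ε i ω

/-- `j → i` is an edge of the model and it is linear with coefficient `a`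
(a constant term is allowed; it may be moved to the error of `i`). -/
def IsLinearEdge (M : AdditiveSEM V) (j i : V) (a : ℝ) : Prop :=
  M.graph.Adj j i ∧ ∃ b : ℝ, ∀ x, M.f j i x = a * x + b

/-- The model is linear below `CA` and `CB` for `A` and `B`: every edge on a directed path from `CA`
to `A`, or from `CB` to `B`, is linear. -/
def LinearBelow (M : AdditiveSEM V) (CA CB A B : Finset V) : Prop :=
  ∀ j i, EdgeOnPath M.graph CA A j i ∨ EdgeOnPath M.graph CB B j i → ∃ a, M.IsLinearEdge j i a

/-- `L` is the coefficient matrix of a set of linear edges that includes all edges on directed paths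
from `CA` to `A` or from `CB` to `B`: the entry `L i j` is the coefficient of the edge `j → i` if
this edge is in the set, and `0` otherwise. -/
def IsLinearPart (M : AdditiveSEM V) (CA CB A B : Finset V) (L : Matrix V V ℝ) : Prop :=
  ∃ F : V → V → Prop,
    (∀ j i, EdgeOnPath M.graph CA A j i ∨ EdgeOnPath M.graph CB B j i → F j i) ∧
    (∀ j i, F j i → M.IsLinearEdge j i (L i j)) ∧
    (∀ j i, ¬ F j i → L i j = 0)

end AdditiveSEM

/-- The cross-covariance matrix `Σ_{A,B}`, with rows indexed by `A` and columns by `B`. -/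
noncomputable def crossCov {V Ω : Type*} [MeasurableSpace Ω] (μ : Measure Ω) (X : V → Ω → ℝ)
    (A B : Finset V) : Matrix A B ℝ :=
  Matrix.of fun a b => cov[X a, X b; μ]

/-! ### Linear algebra: coranks and rank bounds -/

namespace Matrix

/-! Let `PA` be the set of vertices with a directed path to `A` that avoids `CA`, and `PB` likewise
for `B` and `CB`; t-separation makes them disjoint. Put `K = 1 - L`. For `i ∈ PA` the residual `(K
X) i` is the error of `i` plus constants plus `f j i (X j)` over parents `j` whose edge is not in
`F`. Such a `j` is no descendant of `CA`, so all its ancestors lie in `PA` and `X j` is a function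
of the errors in `PA` (`Follows.exists_measurable_residual`). Residuals over `PA` are thus
independent of those over `PB`, hence uncorrelated.

The rows of `K` in `PA` are independent and supported on `PA ∪ CA`, so they have corank at most
`|CA|` there; similarly for `PB`. Multiplying the covariance of `PA ∪ CA` and `PB ∪ CB` by these two
blocks gives zero, which bounds its rank (`Matrix.rank_le_of_mul_mul_eq_zero`). -/

theorem rank_add_le {m n R : Type*} [Fintype m] [Fintype n] [Field R] (A B : Matrix m n R) :
    (A + B).rank ≤ A.rank + B.rank := by
  have h : LinearMap.range (A + B).mulVecLin ≤
      LinearMap.range A.mulVecLin ⊔ LinearMap.range B.mulVecLin := by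
    rintro _ ⟨x, rfl⟩
    rw [mulVecLin_add]
    exact Submodule.add_mem_sup ⟨x, rfl⟩ ⟨x, rfl⟩
  exact (Submodule.finrank_mono h).trans (Submodule.finrank_add_le_finrank_add_finrank _ _)

/-- If `T` has a right inverse, `S` has a left inverse and `T * Y * S = 0`, then the rank of `Y` is
bounded by the sum of the corank of `T` and the corank of `S`. -/
theorem rank_le_of_mul_mul_eq_zero {m n p q R : Type*} [Fintype m] [Fintype n] [Fintype p]
    [Fintype q] [DecidableEq m] [DecidableEq n] [DecidableEq p] [DecidableEq q] [Field R]
    {T : Matrix p m R} {N : Matrix m p R} (hTN : T * N = 1)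
    {S : Matrix n q R} {N' : Matrix q n R} (hS : N' * S = 1)
    {Y : Matrix m n R} (h : T * Y * S = 0) {c d : ℕ}
    (hc : Fintype.card m ≤ Fintype.card p + c) (hd : Fintype.card n ≤ Fintype.card q + d) :
    Y.rank ≤ c + d := by
  have hT : Fintype.card p ≤ T.rank := by
    simpa [hTN] using rank_mul_le_left T N
  have hS' : Fintype.card q ≤ S.rank := by
    simpa [hS] using rank_mul_le_right N' S
  -- Since `T` kills `Y * S`, the rank of `Y * S` is at most the corank of `T`. Since `1 - S * N'`
  -- kills `S`, its rank is at most the corank of `S`. The splitting `h3` of `Y` adds the two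
  -- bounds.
  have h1 : T.rank + (Y * S).rank ≤ Fintype.card m :=
    rank_add_rank_le_card_of_mul_eq_zero (by rw [← Matrix.mul_assoc, h])
  have h2 : (1 - S * N').rank + S.rank ≤ Fintype.card n :=
    rank_add_rank_le_card_of_mul_eq_zero (by
      rw [Matrix.sub_mul, Matrix.mul_assoc, hS, Matrix.one_mul, Matrix.mul_one, sub_self])
  have h3 : Y = Y * S * N' + Y * (1 - S * N') := by
    rw [Matrix.mul_sub, Matrix.mul_one, Matrix.mul_assoc]; abel
  have h4 := rank_mul_le_left (Y * S) N'
  have h5 := rank_mul_le_right Y (1 - S * N')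
  have h6 := rank_add_le (Y * S * N') (Y * (1 - S * N'))
  rw [← h3] at h6
  omega

/-- The rows of an invertible matrix with index in `P`, if supported on `D`, have a right inverse. -/
theorem submatrix_mul_inv_submatrix {V R : Type*} [Fintype V] [DecidableEq V] [Field R]
    {K : Matrix V V R} (hK : IsUnit K) {P D : Finset V} (hP : ∀ i ∈ P, ∀ j ∉ D, K i j = 0) :
    K.submatrix (Subtype.val : P → V) (Subtype.val : D → V) *
      K⁻¹.submatrix (Subtype.val : D → V) (Subtype.val : P → V) = 1 := by
  have h1 : K * K⁻¹ = 1 := K.mul_nonsing_inv ((isUnit_iff_isUnit_det K).1 hK)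
  ext i k
  have h2 := congrFun₂ h1 i k
  rw [mul_apply] at h2 ⊢
  simp only [submatrix_apply]
  rw [Finset.sum_coe_sort D fun j => K i j * K⁻¹ j k,
    Finset.sum_subset D.subset_univ fun j _ hj => by rw [hP i i.2 j hj, zero_mul], h2]
  simp only [one_apply, Subtype.ext_iff]

end Matrix

/-! ### Directed paths -/

section Paths

variable {V : Type*} {G : Digraph V} {s t u v : V} {p q : List V}

theorem isDirectedPath_singleton (s : V) : IsDirectedPath G s s [s] := by
  simp [IsDirectedPath]

theorem IsDirectedPath.append (hp : IsDirectedPath G s t p) (hq : IsDirectedPath G u v q)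
    (h : G.Adj t u) : IsDirectedPath G s v (p ++ q) := by
  obtain ⟨hp1, hp2, hp3⟩ := hp
  obtain ⟨hq1, hq2, hq3⟩ := hq
  refine ⟨List.isChain_append.2 ⟨hp1, hq1, ?_⟩, ?_, ?_⟩
  · simpa [hp3, hq2] using h
  · simp [List.head?_append, hp2]
  · simp [List.getLast?_append, hq3]

theorem IsDirectedPath.cons (hq : IsDirectedPath G u v q) (h : G.Adj t u) :
    IsDirectedPath G t v (t :: q) :=
  (isDirectedPath_singleton t).append hq h

theorem EdgeOnPath.of_paths {C S : Finset V} (hs : s ∈ C) (hv : v ∈ S)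
    (hp : IsDirectedPath G s t p) (hq : IsDirectedPath G u v q) (h : G.Adj t u) :
    EdgeOnPath G C S t u := by
  refine ⟨s, hs, v, hv, p ++ q, hp.append hq h, ?_⟩
  obtain ⟨p', rfl⟩ := List.getLast?_eq_some_iff.1 hp.2.2
  obtain ⟨q', rfl⟩ := List.head?_eq_some_iff.1 hq.2.1
  exact ⟨p', q', by simp⟩

open Classical in
/-- The vertices from which there is a directed path to `A` that avoids `C`. -/
noncomputable def reachAvoiding [Fintype V] (G : Digraph V) (C A : Finset V) : Finset V :=
  Finset.univ.filter fun v => ∃ a ∈ A, ∃ p, IsDirectedPath G v a p ∧ ∀ c ∈ C, c ∉ p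

theorem mem_reachAvoiding [Fintype V] {C A : Finset V} :
    v ∈ reachAvoiding G C A ↔ ∃ a ∈ A, ∃ p, IsDirectedPath G v a p ∧ ∀ c ∈ C, c ∉ p := by
  simp [reachAvoiding]

theorem mem_reachAvoiding_of_mem [Fintype V] {C A : Finset V} (hv : v ∈ A) (hC : v ∉ C) :
    v ∈ reachAvoiding G C A :=
  mem_reachAvoiding.2 ⟨v, hv, [v], isDirectedPath_singleton v, fun c hc h => by
    rw [List.mem_singleton] at h; exact hC (h ▸ hc)⟩

theorem mem_reachAvoiding_of_adj [Fintype V] {C A : Finset V} (hv : v ∈ reachAvoiding G C A)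
    (h : G.Adj u v) (hC : u ∉ C) : u ∈ reachAvoiding G C A := by
  obtain ⟨a, ha, p, hp, hav⟩ := mem_reachAvoiding.1 hv
  refine mem_reachAvoiding.2 ⟨a, ha, u :: p, hp.cons h, fun c hc hmem => ?_⟩
  rcases List.mem_cons.1 hmem with rfl | hmem
  · exact hC hc
  · exact hav c hc hmem

/-- At a common vertex, the two avoiding paths would form a trek that violates t-separation. -/
theorem TSeparates.disjoint_reachAvoiding [Fintype V] {CA CB A B : Finset V}
    (h : TSeparates G CA CB A B) :
    Disjoint (reachAvoiding G CA A) (reachAvoiding G CB B) := by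
  rw [Finset.disjoint_left]
  intro s hA hB
  obtain ⟨a, ha, p, hp, hp'⟩ := mem_reachAvoiding.1 hA
  obtain ⟨b, hb, q, hq, hq'⟩ := mem_reachAvoiding.1 hB
  rcases h a ha b hb s p q hp hq with ⟨c, hc, h⟩ | ⟨c, hc, h⟩
  · exact hp' c hc h
  · exact hq' c hc h

end Paths

/-! ### Random variables that are functions of the errors -/

namespace AdditiveSEM

variable {V : Type*} [Fintype V] {M : AdditiveSEM V} {Ω : Type*} [MeasurableSpace Ω]
  {μ : Measure Ω} {ε X : V → Ω → ℝ}

theorem Follows.map_errors [IsProbabilityMeasure μ] (hX : M.Follows μ ε X) (S : Finset V) :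
    μ.map (fun ω (i : S) => ε i ω) = Measure.pi fun i : S => (M.errorLaw i : Measure ℝ) := by
  have h := hX.indep_error.precomp (g := (Subtype.val : S → V)) Subtype.val_injective
  rw [h.map_fun_eq_pi_map fun i : S => (hX.measurable_error i).aemeasurable]
  congr with i : 1
  exact hX.law_error i

/-- On an ancestral set, the variables are almost surely a measurable function of the errors. -/
theorem Follows.exists_measurable_solution [IsProbabilityMeasure μ] (hM : M.UniquelySolvable)
    (hX : M.Follows μ ε X) {S : Finset V} (hS : M.IsAncestral S) :
    ∃ g : (S → ℝ) → (S → ℝ), Measurable g ∧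
      ∀ᵐ ω ∂μ, (fun i : S => X i ω) = g fun i : S => ε i ω := by
  classical
  let φ : (S → ℝ) → (S → ℝ) := fun x i =>
    x i - ∑ j : S, if M.graph.Adj j i then M.f j i (x j) else 0
  have hφ : Measurable φ := by
    refine measurable_pi_lambda _ fun i => (measurable_pi_apply i).sub ?_
    refine Finset.measurable_sum _ fun j _ => ?_
    split_ifs with h
    · exact (M.smooth j i h).continuous.measurable.comp (measurable_pi_apply j)
    · exact measurable_const
  have hsol : ∀ e x, M.SolvesOn S e x ↔ φ x = e := fun e x => by
    simp only [SolvesOn, funext_iff, φ, sub_eq_iff_eq_add']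
  have hmeas : Measurable fun ω (i : S) => ε i ω :=
    measurable_pi_lambda _ fun i => hX.measurable_error i
  have hae := hM S hS
  rw [← hX.map_errors S] at hae
  obtain ⟨E, hEae, hEm, hE⟩ := hae.exists_measurable_mem
  have hD : MeasurableSet (φ ⁻¹' E) := hφ hEm
  have : StandardBorelSpace (φ ⁻¹' E) := hD.standardBorel
  have hinj : Function.Injective fun x : φ ⁻¹' E => φ x := fun x y hxy =>
    Subtype.ext ((hE _ x.2).unique ((hsol _ _).2 rfl) ((hsol _ _).2 hxy.symm))
  -- Lusin–Souslin: an injective measurable map between standard Borel spaces has a measurable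
  -- inverse on its range, which then extends to all error values.
  have hemb : MeasurableEmbedding fun x : φ ⁻¹' E => φ x :=
    (hφ.comp measurable_subtype_coe).measurableEmbedding hinj
  obtain ⟨g, hg, hgφ⟩ := hemb.exists_measurable_extend measurable_subtype_coe fun _ => ⟨0⟩
  refine ⟨g, hg, ?_⟩
  have hE' : ∀ᵐ ω ∂μ, (fun i : S => ε i ω) ∈ E := ae_of_ae_map hmeas.aemeasurable hEae
  have heq : ∀ᵐ ω ∂μ, ∀ i, X i ω =
      (∑ j, if M.graph.Adj j i then M.f j i (X j ω) else 0) + ε i ω := ae_all_iff.2 hX.equation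
  filter_upwards [hE', heq] with ω h1 h2
  have h3 : φ (fun i : S => X i ω) = fun i : S => ε i ω := by
    rw [← hsol]
    intro i
    beta_reduce
    rw [h2 i, Finset.sum_coe_sort S fun j => if M.graph.Adj j i then M.f j i (X j ω) else 0,
      Finset.sum_subset S.subset_univ fun j _ hj => if_neg fun h => hj (hS j i h i.2)]
  have h4 := congrFun hgφ ⟨fun i : S => X i ω, by rw [Set.mem_preimage, h3]; exact h1⟩
  simp only [Function.comp_apply, h3] at h4
  exact h4.symm

/-- Let `P` be the set of vertices with a directed path to `A` that avoids `C`. The residuals of the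
linear part at the vertices in `P` are almost surely functions of the errors in `P`. -/
theorem Follows.exists_measurable_residual [IsProbabilityMeasure μ] [DecidableEq V]
    (hM : M.UniquelySolvable)
    (hX : M.Follows μ ε X) {A C : Finset V} {F : V → V → Prop} {L : Matrix V V ℝ}
    (hF : ∀ j i, EdgeOnPath M.graph C A j i → F j i)
    (hL : ∀ j i, F j i → M.IsLinearEdge j i (L i j)) (hL0 : ∀ j i, ¬ F j i → L i j = 0)
    {i : V} (hi : i ∈ reachAvoiding M.graph C A) :
    ∃ ψ : (reachAvoiding M.graph C A → ℝ) → ℝ, Measurable ψ ∧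
      (fun ω => ∑ j, (1 - L) i j * X j ω) =ᵐ[μ] fun ω => ψ fun k => ε k ω := by
  classical
  set P := reachAvoiding M.graph C A with hP
  obtain ⟨a, ha, p, hp, -⟩ := mem_reachAvoiding.1 hi
  -- Removing the descendants of `C` makes the set ancestral: a parent of a vertex of `Q` is no
  -- descendant of `C`, so it is not in `C` and extends the avoiding path.
  let Q : Finset V := P.filter fun v => ¬ ∃ c ∈ C, ∃ q, IsDirectedPath M.graph c v q
  have hQ : M.IsAncestral Q := by
    intro u v huv hv
    obtain ⟨hvP, hvC⟩ := Finset.mem_filter.1 hv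
    have huC : ¬ ∃ c ∈ C, ∃ q, IsDirectedPath M.graph c u q := by
      rintro ⟨c, hc, q, hq⟩
      exact hvC ⟨c, hc, _, hq.append (isDirectedPath_singleton v) huv⟩
    exact Finset.mem_filter.2 ⟨mem_reachAvoiding_of_adj hvP huv
      fun h => huC ⟨u, h, _, isDirectedPath_singleton u⟩, huC⟩
  obtain ⟨g, hg, hgX⟩ := hX.exists_measurable_solution hM hQ
  have hterm : ∀ j, ∃ ψ : (P → ℝ) → ℝ, Measurable ψ ∧ ∀ᵐ ω ∂μ,
      (if M.graph.Adj j i then M.f j i (X j ω) else 0) - L i j * X j ω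
        = ψ fun k : P => ε k ω := by
    intro j
    by_cases hji : F j i
    -- An edge in `F` cancels against `L i j * X j` up to its constant term.
    · obtain ⟨hadj, b, hb⟩ := hL j i hji
      exact ⟨fun _ => b, measurable_const, ae_of_all _ fun ω => by simp [hadj, hb]⟩
    rw [hL0 j i hji]
    by_cases hadj : M.graph.Adj j i
    -- A path from `C` to `j`, continued through `i` to `A`, would put the edge in `F`.
    · have hjC : ¬ ∃ c ∈ C, ∃ q, IsDirectedPath M.graph c j q := by
        rintro ⟨c, hc, q, hq⟩
        exact hji (hF j i (EdgeOnPath.of_paths hc ha hq hp hadj))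
      have hjQ : j ∈ Q := Finset.mem_filter.2 ⟨mem_reachAvoiding_of_adj hi hadj
        fun h => hjC ⟨j, h, _, isDirectedPath_singleton j⟩, hjC⟩
      refine ⟨fun e => M.f j i (g (fun k : Q => e ⟨k, (Finset.mem_filter.1 k.2).1⟩) ⟨j, hjQ⟩),
        ?_, ?_⟩
      · refine (M.smooth j i hadj).continuous.measurable.comp
          ((measurable_pi_apply _).comp (hg.comp (measurable_pi_lambda _ fun k => ?_)))
        exact measurable_pi_apply _
      · filter_upwards [hgX] with ω hω
        rw [← hω]
        simp [hadj]
    · exact ⟨fun _ => 0, measurable_const, ae_of_all _ fun ω => by simp [hadj]⟩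
  choose ψ hψ hψX using hterm
  refine ⟨fun e => ∑ j, ψ j e + e ⟨i, hi⟩,
    (Finset.measurable_sum _ fun j _ => hψ j).add (measurable_pi_apply _), ?_⟩
  filter_upwards [hX.equation i, ae_all_iff.2 hψX] with ω h1 h2
  simp only [← h2, Finset.sum_sub_distrib, Matrix.sub_apply, sub_mul, Matrix.one_apply, ite_mul,
    one_mul, zero_mul, Finset.sum_ite_eq, Finset.mem_univ, if_true]
  linarith

end AdditiveSEM

/-! ### From uncorrelated residuals to the rank bound -/

/-- The cross-covariance matrix has rank at most `|CA| + |CB|` if, for an invertible `K`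
whose rows in `PA` and `PB` are supported on `PA ∪ CA` and `PB ∪ CB`, the linear combinations of the
variables given by the rows in `PA` are uncorrelated with those given by the rows in `PB`. -/
theorem rank_crossCov_le_of_covariance_eq_zero {V Ω : Type*} [Fintype V] [DecidableEq V]
    [MeasurableSpace Ω] {μ : Measure Ω} [IsProbabilityMeasure μ] {X : V → Ω → ℝ}
    (hvar : ∀ i, MemLp (X i) 2 μ) {K : Matrix V V ℝ} (hK : IsUnit K) {A B CA CB PA PB : Finset V}
    (hA : A ⊆ PA ∪ CA) (hB : B ⊆ PB ∪ CB)
    (hKA : ∀ i ∈ PA, ∀ j ∉ PA ∪ CA, K i j = 0) (hKB : ∀ i ∈ PB, ∀ j ∉ PB ∪ CB, K i j = 0)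
    (hcov : ∀ i ∈ PA, ∀ k ∈ PB,
      cov[fun ω => ∑ j, K i j * X j ω, fun ω => ∑ l, K k l * X l ω; μ] = 0) :
    (crossCov μ X A B).rank ≤ CA.card + CB.card := by
  have hsub : crossCov μ X A B = (crossCov μ X (PA ∪ CA) (PB ∪ CB)).submatrix
      (fun a : A => ⟨a, hA a.2⟩) (fun b : B => ⟨b, hB b.2⟩) := rfl
  rw [hsub]
  refine (Matrix.rank_submatrix_le _ _ _).trans ?_
  have hTB := congrArg Matrix.transpose (Matrix.submatrix_mul_inv_submatrix hK hKB)
  rw [Matrix.transpose_mul, Matrix.transpose_one] at hTB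
  refine Matrix.rank_le_of_mul_mul_eq_zero (Matrix.submatrix_mul_inv_submatrix hK hKA) hTB ?_
    (by simpa only [Fintype.card_coe] using Finset.card_union_le PA CA)
    (by simpa only [Fintype.card_coe] using Finset.card_union_le PB CB)
  ext i k
  have h := hcov i i.2 k k.2
  rw [covariance_fun_sum_fun_sum (fun j => (hvar j).const_mul _)
    (fun j => (hvar j).const_mul _)] at h
  simp only [covariance_const_mul_left, covariance_const_mul_right] at h
  rw [Matrix.mul_assoc, Matrix.mul_apply, Matrix.zero_apply, ← h]
  simp only [Matrix.mul_apply, Matrix.submatrix_apply, Matrix.transpose_apply, crossCov,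
    Matrix.of_apply, Finset.mul_sum]
  -- The support conditions on `K` let the block sums run over all vertices, as in the covariance of
  -- the residuals.
  rw [Finset.sum_coe_sort (PA ∪ CA) fun j =>
      ∑ l : ↥(PB ∪ CB), K i j * (cov[X j, X l; μ] * K k l),
    Finset.sum_subset (PA ∪ CA).subset_univ fun j _ hj => by simp [hKA i i.2 j hj]]
  refine Finset.sum_congr rfl fun j _ => ?_
  rw [Finset.sum_coe_sort (PB ∪ CB) fun l => K i j * (cov[X j, X l; μ] * K k l),
    Finset.sum_subset (PB ∪ CB).subset_univ fun l _ hl => by simp [hKB k k.2 l hl]]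
  exact Finset.sum_congr rfl fun l _ => by ring

/-- A parent of a vertex that reaches `A` avoiding `C` does so too, unless it lies in `C`. -/
theorem AdditiveSEM.one_sub_apply_eq_zero {V : Type*} [Fintype V] [DecidableEq V]
    {M : AdditiveSEM V} {F : V → V → Prop} {L : Matrix V V ℝ}
    (hL : ∀ j i, F j i → M.IsLinearEdge j i (L i j)) (hL0 : ∀ j i, ¬ F j i → L i j = 0)
    {C A : Finset V} {i j : V} (hi : i ∈ reachAvoiding M.graph C A)
    (hj : j ∉ reachAvoiding M.graph C A ∪ C) : (1 - L) i j = 0 := by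
  rw [Finset.mem_union, not_or] at hj
  have hij : i ≠ j := fun h => hj.1 (h ▸ hi)
  have hF : ¬ F j i := fun h => hj.1 (mem_reachAvoiding_of_adj hi (hL j i h).1 hj.2)
  rw [Matrix.sub_apply, Matrix.one_apply_ne hij, hL0 j i hF, sub_zero]

theorem subset_reachAvoiding_union {V : Type*} [Fintype V] [DecidableEq V] (G : Digraph V)
    (C A : Finset V) : A ⊆ reachAvoiding G C A ∪ C := fun a ha => by
  by_cases h : a ∈ C
  · exact Finset.mem_union_right _ h
  · exact Finset.mem_union_left _ (mem_reachAvoiding_of_mem ha h)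

theorem mainTheorem5 {V : Type*} [Fintype V] [DecidableEq V] {Ω : Type*} [MeasurableSpace Ω]
    (μ : Measure Ω) [IsProbabilityMeasure μ]
    (M : AdditiveSEM V) (hM : M.UniquelySolvable)
    (ε X : V → Ω → ℝ) (hX : M.Follows μ ε X) (hvar : ∀ i, MemLp (X i) 2 μ)
    (A B CA CB : Finset V) (hsep : TSeparates M.graph CA CB A B)
    (hlin : M.LinearBelow CA CB A B)
    (L : Matrix V V ℝ) (hL : M.IsLinearPart CA CB A B L) (hinv : IsUnit (1 - L)) :
    (crossCov μ X A B).rank ≤ CA.card + CB.card := by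
  obtain ⟨F, hF, hFL, hL0⟩ := hL
  refine rank_crossCov_le_of_covariance_eq_zero hvar hinv
    (subset_reachAvoiding_union M.graph CA A) (subset_reachAvoiding_union M.graph CB B)
    (fun i hi j hj => AdditiveSEM.one_sub_apply_eq_zero hFL hL0 hi hj)
    (fun i hi j hj => AdditiveSEM.one_sub_apply_eq_zero hFL hL0 hi hj) fun i hi k hk => ?_
  obtain ⟨ψ, hψ, hψX⟩ :=
    hX.exists_measurable_residual hM (fun j i h => hF j i (Or.inl h)) hFL hL0 hi
  obtain ⟨χ, hχ, hχX⟩ :=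
    hX.exists_measurable_residual hM (fun j i h => hF j i (Or.inr h)) hFL hL0 hk
  have hind := hX.indep_error.indepFun_finset _ _ hsep.disjoint_reachAvoiding hX.measurable_error
  exact ((hind.comp hψ hχ).congr hψX.symm hχX.symm).covariance_eq_zero
    (memLp_finsetSum _ fun j _ => (hvar j).const_mul _)
    (memLp_finsetSum _ fun j _ => (hvar j).const_mul _)
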